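/- Let $(X_0,X_1)$ be a compatible couple of (real or complex) Banach spaces, i.e. $X_0$ and $X_1$ are Banach spaces continuously embedded in a common Hausdorff topological vector space. Equip $X_0+X_1$ with the norm $\|f\|_{X_0+X_1}=\inf\{\|f_0\|_{X_0}+\|f_1\|_{X_1}: f=f_0+f_1,\ f_0\in X_0,\ f_1\in X_1\}$ and $X_0\cap X_1$ with the norm $\max\{\|f\|_{X_0},\|f\|_{X_1}\}$, and for $f\in X_0\cap X_1$ and $t>0$ put $J(f,t)=\max\{\|f\|_{X_0},\,t\|f\|_{X_1}\}$. Two non-negative functions on $(0,\infty)$ are called equivalent if each is bounded above by a positive constant multiple of the other. Let $SV(0,\infty)$ be the class of all positive, finite, Lebesgue measurable functions $b$ on $(0,\infty)$ such that, for every $\varepsilon>0$, $t^{\varepsilon}b(t)$ is equivalent to a non-decreasing function on $(0,\infty)$ and $t^{-\varepsilon}b(t)$ is equivalent to a non-increasing function on $(0,\infty)$. For $1<q<\infty$ and $a\in SV(0,\infty)$, let $$\|f\|_{0,q,a;J}=\inf_u\Big(\int_0^\infty \big(a(t)\,J(u(t),t)\big)^q\,\frac{dt}{t}\Big)^{1/q},\qquad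 f\in X_0+X_1,$$ where the infimum is taken over all strongly measurable $u:(0,\infty)\to X_0\cap X_1$ such that $f=\int_0^\infty u(s)\,\frac{ds}{s}$ as a Bochner integral in $X_0+X_1$ (with $\inf\emptyset=\infty$), and let $(X_0,X_1)_{0,q,a;J}=\{f\in X_0+X_1:\|f\|_{0,q,a;J}<\infty\}$. **Theorem.** Let $(X_0,X_1)$ be a compatible couple, let $1<q<\infty$ and $1/q+1/q'=1$. If $a\in SV(0,\infty)$ satisfies $$\int_0^\infty t^{-1}a(t)^{-q'}\,dt<\infty,$$ then $X_0\cap X_1$ is dense in $(X_0,X_1)_{0,q,a;J}$; that is, $X_0\cap X_1\subset (X_0,X_1)_{0,q,a;J}$ and for every $f\in (X_0,X_1)_{0,q,a;J}$ and every $\varepsilon>0$ there is $g\in X_0\cap X_1$ with $\|f-g\|_{0,q,a;J}<\varepsilon$. -/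

import Mathlib

open MeasureTheory Set
open scoped ENNReal

noncomputable section

set_option linter.unusedSectionVars false

/-- Two functions on `(0, ∞)` are equivalent: each is at most a positive constant times the other. -/
def EquivOnPos (f g : ℝ → ℝ) : Prop :=
  ∃ c C : ℝ, 0 < c ∧ 0 < C ∧ ∀ t : ℝ, 0 < t → c * g t ≤ f t ∧ f t ≤ C * g t

/-- The class `SV(0, ∞)`: positive (finite) Lebesgue measurable functions `b` on `(0, ∞)` such that,
for each `ε > 0`, `t ^ ε * b t` is equivalent to a non-decreasing function and `t ^ (-ε) * b t` is
equivalent to a non-increasing function on `(0, ∞)`. Values outside `(0, ∞)` are irrelevant. -/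
structure SlowlyVarying (b : ℝ → ℝ) : Prop where
  pos : ∀ t : ℝ, 0 < t → 0 < b t
  aemeasurable : AEMeasurable b (volume.restrict (Ioi (0 : ℝ)))
  equiv_monotone : ∀ ε : ℝ, 0 < ε →
    ∃ φ : ℝ → ℝ, MonotoneOn φ (Ioi 0) ∧ EquivOnPos (fun t => t ^ ε * b t) φ
  equiv_antitone : ∀ ε : ℝ, 0 < ε →
    ∃ ψ : ℝ → ℝ, AntitoneOn ψ (Ioi 0) ∧ EquivOnPos (fun t => t ^ (-ε) * b t) ψ

section Couple

variable (𝕜 : Type*) [RCLike 𝕜]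
  (X₀ : Type*) [NormedAddCommGroup X₀] [NormedSpace 𝕜 X₀]
  (X₁ : Type*) [NormedAddCommGroup X₁] [NormedSpace 𝕜 X₁]
  (E : Type*) [AddCommGroup E] [Module 𝕜 E] [TopologicalSpace E]

/-- Continuous embeddings of two normed spaces `X₀`, `X₁` into a common topological vector space `E`.
When `X₀`, `X₁` are Banach spaces and `E` is a Hausdorff topological vector space, this says that
`(X₀, X₁)` is a compatible couple. -/
structure CompatibleCouple where
  ι₀ : X₀ →L[𝕜] E
  ι₁ : X₁ →L[𝕜] E
  injective_ι₀ : Function.Injective ι₀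
  injective_ι₁ : Function.Injective ι₁

end Couple

namespace CompatibleCouple

variable {𝕜 : Type*} [RCLike 𝕜]
  {X₀ : Type*} [NormedAddCommGroup X₀] [NormedSpace 𝕜 X₀]
  {X₁ : Type*} [NormedAddCommGroup X₁] [NormedSpace 𝕜 X₁]
  {E : Type*} [AddCommGroup E] [Module 𝕜 E] [TopologicalSpace E]
  [IsTopologicalAddGroup E] [ContinuousSMul 𝕜 E] [T2Space E]

/-- `{(x, y) : ι₀ x = ι₁ y}`, that is, the pairs consisting of an element of `X₀ ∩ X₁` seen in `X₀`
and the same element seen in `X₁`. -/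
def interSubmodule (C : CompatibleCouple 𝕜 X₀ X₁ E) : Submodule 𝕜 (X₀ × X₁) where
  carrier := {p | C.ι₀ p.1 = C.ι₁ p.2}
  add_mem' := by
    intro p r hp hr
    change C.ι₀ p.1 = C.ι₁ p.2 at hp
    change C.ι₀ r.1 = C.ι₁ r.2 at hr
    change C.ι₀ (p.1 + r.1) = C.ι₁ (p.2 + r.2)
    rw [map_add, map_add, hp, hr]
  zero_mem' := by simp
  smul_mem' := by
    intro c p hp
    change C.ι₀ p.1 = C.ι₁ p.2 at hp
    change C.ι₀ (c • p.1) = C.ι₁ (c • p.2)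
    rw [map_smul, map_smul, hp]

/-- The space `X₀ ∩ X₁`, with the norm `max ‖f‖_{X₀} ‖f‖_{X₁}` (inherited from `X₀ × X₁`). -/
abbrev Inter (C : CompatibleCouple 𝕜 X₀ X₁ E) : Type _ := C.interSubmodule

/-- An element of `X₀ ∩ X₁` as an element of `X₀`. -/
def Inter.left {C : CompatibleCouple 𝕜 X₀ X₁ E} (f : C.Inter) : X₀ := f.1.1

/-- An element of `X₀ ∩ X₁` as an element of `X₁`. -/
def Inter.right {C : CompatibleCouple 𝕜 X₀ X₁ E} (f : C.Inter) : X₁ := f.1.2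

theorem Inter.norm_eq {C : CompatibleCouple 𝕜 X₀ X₁ E} (f : C.Inter) :
    ‖f‖ = max ‖f.left‖ ‖f.right‖ := rfl

/-- The map `(x, y) ↦ ι₀ x + ι₁ y` from the `ℓ¹`-direct sum of `X₀` and `X₁` to `E`; its range is
`X₀ + X₁`. -/
def sumMap (C : CompatibleCouple 𝕜 X₀ X₁ E) : WithLp 1 (X₀ × X₁) →L[𝕜] E :=
  (C.ι₀.coprod C.ι₁).comp
    (WithLp.prodContinuousLinearEquiv 1 𝕜 X₀ X₁ : WithLp 1 (X₀ × X₁) →L[𝕜] X₀ × X₁)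

theorem sumMap_apply (C : CompatibleCouple 𝕜 X₀ X₁ E) (p : WithLp 1 (X₀ × X₁)) :
    C.sumMap p = C.ι₀ p.fst + C.ι₁ p.snd := rfl

/-- The pairs `(x, y)` with `x + y = 0` in `E`. -/
def sumKer (C : CompatibleCouple 𝕜 X₀ X₁ E) : Submodule 𝕜 (WithLp 1 (X₀ × X₁)) :=
  LinearMap.ker (C.sumMap : WithLp 1 (X₀ × X₁) →ₗ[𝕜] E)

instance isClosed_sumKer (C : CompatibleCouple 𝕜 X₀ X₁ E) :
    IsClosed (C.sumKer : Set (WithLp 1 (X₀ × X₁))) :=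
  C.sumMap.isClosed_ker

/-- The space `X₀ + X₁`, realised as the quotient of the `ℓ¹`-direct sum of `X₀` and `X₁` by the
kernel of `(x, y) ↦ x + y`. Its quotient norm is `inf {‖f₀‖ + ‖f₁‖ : f = f₀ + f₁}`
(see `norm_sum_eq`), and `toAmbient` identifies it with the subspace `X₀ + X₁` of `E`
(see `toAmbient_injective` and `range_toAmbient`). -/
def Sum (C : CompatibleCouple 𝕜 X₀ X₁ E) : Type _ := WithLp 1 (X₀ × X₁) ⧸ C.sumKer

instance (C : CompatibleCouple 𝕜 X₀ X₁ E) : NormedAddCommGroup C.Sum :=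
  inferInstanceAs (NormedAddCommGroup (WithLp 1 (X₀ × X₁) ⧸ C.sumKer))

instance (C : CompatibleCouple 𝕜 X₀ X₁ E) : NormedSpace 𝕜 C.Sum :=
  inferInstanceAs (NormedSpace 𝕜 (WithLp 1 (X₀ × X₁) ⧸ C.sumKer))

/-- The underlying real normed space of `X₀ + X₁`. -/
instance instRealSum (C : CompatibleCouple 𝕜 X₀ X₁ E) : NormedSpace ℝ C.Sum :=
  NormedSpace.restrictScalars ℝ 𝕜 C.Sum

instance [CompleteSpace X₀] [CompleteSpace X₁] (C : CompatibleCouple 𝕜 X₀ X₁ E) :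
    CompleteSpace C.Sum :=
  inferInstanceAs (CompleteSpace (WithLp 1 (X₀ × X₁) ⧸ C.sumKer))

/-- The element `x + y` of `X₀ + X₁`, where `x ∈ X₀` and `y ∈ X₁`. -/
def mkSum (C : CompatibleCouple 𝕜 X₀ X₁ E) (x : X₀) (y : X₁) : C.Sum :=
  C.sumKer.mkQ (WithLp.toLp 1 (x, y))

/-- The inclusion of `X₀ + X₁` into `E`. -/
def toAmbient (C : CompatibleCouple 𝕜 X₀ X₁ E) : C.Sum →ₗ[𝕜] E :=
  C.sumKer.liftQ (C.sumMap : WithLp 1 (X₀ × X₁) →ₗ[𝕜] E) le_rfl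

theorem toAmbient_mkSum (C : CompatibleCouple 𝕜 X₀ X₁ E) (x : X₀) (y : X₁) :
    C.toAmbient (C.mkSum x y) = C.ι₀ x + C.ι₁ y := rfl

theorem toAmbient_injective (C : CompatibleCouple 𝕜 X₀ X₁ E) :
    Function.Injective C.toAmbient := by
  rw [← LinearMap.ker_eq_bot]
  exact Submodule.ker_liftQ_eq_bot _ _ _ le_rfl

theorem exists_mkSum (C : CompatibleCouple 𝕜 X₀ X₁ E) (f : C.Sum) :
    ∃ x y, C.mkSum x y = f := by
  obtain ⟨p, rfl⟩ := Submodule.mkQ_surjective C.sumKer f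
  exact ⟨p.fst, p.snd, rfl⟩

theorem range_toAmbient (C : CompatibleCouple 𝕜 X₀ X₁ E) :
    range C.toAmbient = {z | ∃ x y, z = C.ι₀ x + C.ι₁ y} := by
  ext z
  constructor
  · rintro ⟨f, rfl⟩
    obtain ⟨x, y, rfl⟩ := C.exists_mkSum f
    exact ⟨x, y, rfl⟩
  · rintro ⟨x, y, rfl⟩
    exact ⟨C.mkSum x y, rfl⟩

/-- The norm of `X₀ + X₁`. -/
theorem norm_sum_eq (C : CompatibleCouple 𝕜 X₀ X₁ E) (f : C.Sum) :
    ‖f‖ = sInf {r : ℝ | ∃ x y, C.mkSum x y = f ∧ r = ‖x‖ + ‖y‖} := by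
  apply le_antisymm
  · refine le_csInf ?_ ?_
    · obtain ⟨x, y, h⟩ := C.exists_mkSum f
      exact ⟨_, x, y, h, rfl⟩
    · rintro r ⟨x, y, rfl, rfl⟩
      have h := Submodule.Quotient.norm_mk_le (S := C.sumKer) (WithLp.toLp 1 (x, y))
      rw [WithLp.prod_norm_eq_of_L1] at h
      exact h
  · refine le_of_forall_pos_le_add fun ε hε => ?_
    obtain ⟨p, hp, hlt⟩ := Submodule.Quotient.norm_mk_lt (S := C.sumKer) f hε
    rw [WithLp.prod_norm_eq_of_L1] at hlt
    have hbdd : BddBelow {r : ℝ | ∃ x y, C.mkSum x y = f ∧ r = ‖x‖ + ‖y‖} := by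
      refine ⟨0, ?_⟩
      rintro r ⟨x, y, -, rfl⟩
      positivity
    have hmem : ‖p.fst‖ + ‖p.snd‖ ∈ {r : ℝ | ∃ x y, C.mkSum x y = f ∧ r = ‖x‖ + ‖y‖} :=
      ⟨p.fst, p.snd, hp, rfl⟩
    exact (csInf_le hbdd hmem).trans hlt.le

/-- The inclusion of `X₀ ∩ X₁` into `X₀ + X₁`. -/
def interToSum (C : CompatibleCouple 𝕜 X₀ X₁ E) : C.Inter →ₗ[𝕜] C.Sum where
  toFun f := C.mkSum f.left 0
  map_add' f g := by
    apply C.toAmbient_injective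
    simp [toAmbient_mkSum, Inter.left]
  map_smul' c f := by
    apply C.toAmbient_injective
    simp [toAmbient_mkSum, Inter.left]

/-- The Peetre `J`-functional `J(f, t; X₀, X₁) = max {‖f‖_{X₀}, t ‖f‖_{X₁}}`. -/
def peetreJ (C : CompatibleCouple 𝕜 X₀ X₁ E) (f : C.Inter) (t : ℝ) : ℝ :=
  max ‖f.left‖ (t * ‖f.right‖)

/-- `u : (0, ∞) → X₀ ∩ X₁` is strongly measurable and `f = ∫₀^∞ u(s) ds / s`, as a Bochner integral
in `X₀ + X₁`. -/
structure IsJRepresentation (C : CompatibleCouple 𝕜 X₀ X₁ E) (f : C.Sum) (u : ℝ → C.Inter) :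
    Prop where
  aestronglyMeasurable : AEStronglyMeasurable u (volume.restrict (Ioi (0 : ℝ)))
  integrableOn : IntegrableOn (fun s : ℝ => s⁻¹ • C.interToSum (u s)) (Ioi 0) volume
  integral_eq : ∫ s in Ioi (0 : ℝ), s⁻¹ • C.interToSum (u s) = f

/-- The functional `‖f‖_{θ,q,v;J}`: the infimum over all representations `f = ∫₀^∞ u(s) ds / s` of the
`L_q(0, ∞)`-norm of `t ^ (-θ - 1/q) * v t * J(u t, t; X₀, X₁)`. It is `∞` if `f` has no
representation. -/
def jNorm (C : CompatibleCouple 𝕜 X₀ X₁ E) (θ : ℝ) (q : ℝ≥0∞) (v : ℝ → ℝ) (f : C.Sum) : ℝ≥0∞ :=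
  ⨅ (u : ℝ → C.Inter) (_ : C.IsJRepresentation f u),
    eLpNorm (fun t : ℝ => t ^ (-θ - (q⁻¹).toReal) * v t * C.peetreJ (u t) t) q
      (volume.restrict (Ioi (0 : ℝ)))

/-- The space `(X₀, X₁)_{θ,q,v;J}`. -/
def jSpace (C : CompatibleCouple 𝕜 X₀ X₁ E) (θ : ℝ) (q : ℝ≥0∞) (v : ℝ → ℝ) : Set C.Sum :=
  {f | C.jNorm θ q v f < ∞}

end CompatibleCouple

end

set_option linter.unusedSectionVars false

/-! ### Slowly varying weights on compact intervals -/

namespace SlowlyVarying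

variable {a : ℝ → ℝ}

/-! Density follows by truncating a representation. Let `f = ∫ u(s) ds/s` have finite weighted
`L_q`-norm. On `[r, R]` with `0 < r ≤ 1 ≤ R` the weight is bounded away from `0`
(`exists_bounds_Icc`) and `J(·, t)` dominates `r` times the norm of `X₀ ∩ X₁`, so the `L_q` bound
makes `u(s)/s` Bochner integrable in `X₀ ∩ X₁` itself (`integrableOn_Icc_inter`). Let `g` be its
integral over `[r, R]`. Then `f - g` is represented by `u` cut off outside `[r, R]`
(`IsJRepresentation.sub_integral_Icc`), so its norm is at most the `L_q`-tail of a fixed function,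
which is small for `[r, R]` large because `q < ∞`.

The inclusion `X₀ ∩ X₁ ⊂ (X₀, X₁)_{0,q,a;J}` comes from spreading an element over `[1, e]`, where
all weights are bounded. -/

theorem exists_bounds_Icc (ha : SlowlyVarying a) {r R : ℝ} (hr : 0 < r) (hrR : r ≤ R) :
    ∃ m M : ℝ, 0 < m ∧ 0 < M ∧ ∀ t ∈ Icc r R, m ≤ a t ∧ a t ≤ M := by
  obtain ⟨φ, hφ, c, K, hc, hK, h⟩ := ha.equiv_monotone 1 one_pos
  have hR : 0 < R := hr.trans_le hrR
  simp only [Real.rpow_one] at h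
  have har := mul_pos hr (ha.pos r hr)
  have haR := mul_pos hR (ha.pos R hR)
  have hφr : 0 < φ r := by
    have := (h r hr).2
    exact pos_of_mul_pos_right (har.trans_le this) hK.le
  have hφR : 0 < φ R := hφr.trans_le (hφ hr hR hrR)
  -- `a` need not be continuous, so compactness alone gives no bounds. They come from `t * a t`
  -- being comparable to the monotone `φ`, which lies between `φ r` and `φ R`.
  refine ⟨c * φ r / R, K * φ R / r, by positivity, by positivity, fun t ht => ?_⟩
  have ht0 : 0 < t := hr.trans_le ht.1
  have hat := ha.pos t ht0
  constructor
  · rw [div_le_iff₀ hR]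
    calc c * φ r ≤ c * φ t := by gcongr; exact hφ hr ht0 ht.1
      _ ≤ t * a t := (h t ht0).1
      _ ≤ a t * R := by rw [mul_comm]; gcongr; exact ht.2
  · rw [le_div_iff₀ hr]
    calc a t * r ≤ t * a t := by rw [mul_comm]; gcongr; exact ht.1
      _ ≤ K * φ t := (h t ht0).2
      _ ≤ K * φ R := by gcongr; exact hφ ht0 hR ht.2

end SlowlyVarying

namespace CompatibleCouple

variable {𝕜 : Type*} [RCLike 𝕜]
  {X₀ : Type*} [NormedAddCommGroup X₀] [NormedSpace 𝕜 X₀]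
  {X₁ : Type*} [NormedAddCommGroup X₁] [NormedSpace 𝕜 X₁]
  {E : Type*} [AddCommGroup E] [Module 𝕜 E] [TopologicalSpace E]
  [IsTopologicalAddGroup E] [ContinuousSMul 𝕜 E] [T2Space E]
  (C : CompatibleCouple 𝕜 X₀ X₁ E)

/-! ### The Banach space `X₀ ∩ X₁` and the `J`-functional -/

/-- Uses that `E` is Hausdorff. It yields completeness of `X₀ ∩ X₁`, needed for Bochner integrals to
take values there. -/
theorem isClosed_interSubmodule : IsClosed (C.interSubmodule : Set (X₀ × X₁)) :=
  isClosed_eq (C.ι₀.continuous.comp continuous_fst) (C.ι₁.continuous.comp continuous_snd)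

instance [CompleteSpace X₀] [CompleteSpace X₁] : CompleteSpace C.Inter :=
  C.isClosed_interSubmodule.completeSpace_coe

/-- The underlying real normed space of `X₀ ∩ X₁`. -/
noncomputable instance instRealInter : NormedSpace ℝ C.Inter :=
  NormedSpace.restrictScalars ℝ 𝕜 C.Inter

theorem norm_mkSum_left_le (x : X₀) : ‖C.mkSum x 0‖ ≤ ‖x‖ := by
  have h := Submodule.Quotient.norm_mk_le (S := C.sumKer) (WithLp.toLp 1 (x, 0))
  rw [WithLp.prod_norm_eq_of_L1] at h
  exact h.trans_eq (by simp)

/-- The inclusion of `X₀ ∩ X₁` into `X₀ + X₁` as a continuous real-linear map. -/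
noncomputable def interToSumL : C.Inter →L[ℝ] C.Sum :=
  LinearMap.mkContinuous
    { toFun := C.interToSum
      map_add' := map_add C.interToSum
      map_smul' := fun r f => map_smul C.interToSum (algebraMap ℝ 𝕜 r) f } 1
    fun f => by
      rw [one_mul]
      exact (C.norm_mkSum_left_le f.left).trans ((le_max_left _ _).trans_eq f.norm_eq.symm)

@[simp]
theorem interToSumL_apply (f : C.Inter) : C.interToSumL f = C.interToSum f := rfl

theorem continuous_peetreJ : Continuous fun p : C.Inter × ℝ => C.peetreJ p.1 p.2 := by
  unfold peetreJ Inter.left Inter.right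
  fun_prop

@[simp]
theorem peetreJ_zero (t : ℝ) : C.peetreJ 0 t = 0 := by
  simp [peetreJ, Inter.left, Inter.right]

theorem peetreJ_nonneg (f : C.Inter) (t : ℝ) : 0 ≤ C.peetreJ f t :=
  (norm_nonneg _).trans (le_max_left _ _)

theorem peetreJ_le (f : C.Inter) {t R : ℝ} (hR : 1 ≤ R) (htR : t ≤ R) :
    C.peetreJ f t ≤ R * ‖f‖ := by
  have h0 : ‖f.left‖ ≤ ‖f‖ := (le_max_left _ _).trans_eq f.norm_eq.symm
  have h1 : ‖f.right‖ ≤ ‖f‖ := (le_max_right _ _).trans_eq f.norm_eq.symm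
  refine max_le (h0.trans (le_mul_of_one_le_left (norm_nonneg _) hR)) ?_
  gcongr

theorem mul_norm_le_peetreJ (f : C.Inter) {t r : ℝ} (hr : r ≤ 1) (hrt : r ≤ t) :
    r * ‖f‖ ≤ C.peetreJ f t := by
  rw [f.norm_eq]
  rcases max_cases ‖f.left‖ ‖f.right‖ with ⟨h, -⟩ | ⟨h, -⟩ <;> rw [h]
  · exact (mul_le_of_le_one_left (norm_nonneg _) hr).trans (le_max_left _ _)
  · exact (by gcongr : r * ‖f.right‖ ≤ t * ‖f.right‖).trans (le_max_right _ _)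

/-- The function whose `L_q(0, ∞)`-norm enters the definition of `jNorm`, for `θ = 0`. -/
noncomputable def jWeight (q : ℝ) (a : ℝ → ℝ) (u : ℝ → C.Inter) (t : ℝ) : ℝ :=
  t ^ (-0 - ((ENNReal.ofReal q)⁻¹).toReal) * a t * C.peetreJ (u t) t

variable {C} {q : ℝ} {a : ℝ → ℝ} {u : ℝ → C.Inter} {f : C.Sum}

/-- Holds because `J(0, t) = 0`; it turns truncation of `u` into truncation of a scalar function. -/
theorem jWeight_indicator (s : Set ℝ) :
    C.jWeight q a (s.indicator u) = s.indicator (C.jWeight q a u) := by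
  ext t
  by_cases ht : t ∈ s <;> simp [jWeight, ht]

theorem jNorm_le (h : C.IsJRepresentation f u) :
    C.jNorm 0 (ENNReal.ofReal q) a f ≤
      eLpNorm (C.jWeight q a u) (ENNReal.ofReal q) (volume.restrict (Ioi (0 : ℝ))) :=
  iInf₂_le u h

theorem aestronglyMeasurable_jWeight (ha : SlowlyVarying a)
    (hu : AEStronglyMeasurable u (volume.restrict (Ioi (0 : ℝ)))) :
    AEStronglyMeasurable (C.jWeight q a u) (volume.restrict (Ioi (0 : ℝ))) := by
  refine AEStronglyMeasurable.mul (AEStronglyMeasurable.mul ?_ ha.aemeasurable.aestronglyMeasurable)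
    (C.continuous_peetreJ.comp_aestronglyMeasurable (hu.prodMk aestronglyMeasurable_id))
  exact (measurable_id.pow_const _).aestronglyMeasurable

/-! ### The inclusion of `X₀ ∩ X₁` -/

/-- An element of `X₀ ∩ X₁` is represented by a constant multiple of the indicator of `[1, e]`. -/
theorem isJRepresentation_indicator [CompleteSpace X₀] [CompleteSpace X₁] (g : C.Inter) :
    C.IsJRepresentation (C.interToSum g)
      ((Icc 1 (Real.exp 1)).indicator fun _ => g) := by
  have he : (1 : ℝ) ≤ Real.exp 1 := Real.one_le_exp zero_le_one
  have hsub : Icc 1 (Real.exp 1) ⊆ Ioi (0 : ℝ) := fun t ht => one_pos.trans_le ht.1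
  have hfun : (fun s : ℝ => s⁻¹ • C.interToSum ((Icc 1 (Real.exp 1)).indicator (fun _ => g) s)) =
      (Icc 1 (Real.exp 1)).indicator fun s => s⁻¹ • C.interToSum g := by
    ext s
    by_cases hs : s ∈ Icc 1 (Real.exp 1) <;> simp [hs]
  have hint : IntegrableOn (fun s : ℝ => s⁻¹ • C.interToSum g) (Icc 1 (Real.exp 1)) := by
    have hinv : ContinuousOn (fun s : ℝ => s⁻¹) (Icc 1 (Real.exp 1)) :=
      continuousOn_inv₀.mono fun t ht => (hsub ht).ne'
    exact hinv.integrableOn_Icc.smul_const _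
  refine ⟨?_, ?_, ?_⟩
  · exact (stronglyMeasurable_const.indicator measurableSet_Icc).aestronglyMeasurable
  · rw [hfun]
    exact (hint.integrable_indicator measurableSet_Icc).integrableOn
  -- The endpoint `e` normalises the measure: `∫_1^e ds/s = 1`.
  · rw [hfun, setIntegral_indicator measurableSet_Icc, inter_eq_self_of_subset_right hsub,
      integral_smul_const, integral_Icc_eq_integral_Ioc, ← intervalIntegral.integral_of_le he,
      integral_inv_of_pos one_pos (Real.exp_pos 1)]
    simp

theorem interToSum_mem_jSpace [CompleteSpace X₀] [CompleteSpace X₁]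
    (ha : SlowlyVarying a) (g : C.Inter) :
    C.interToSum g ∈ C.jSpace 0 (ENNReal.ofReal q) a := by
  have he : (1 : ℝ) ≤ Real.exp 1 := Real.one_le_exp zero_le_one
  refine (jNorm_le (isJRepresentation_indicator g)).trans_lt ?_
  rw [jWeight_indicator, eLpNorm_indicator_eq_eLpNorm_restrict measurableSet_Icc,
    Measure.restrict_restrict measurableSet_Icc]
  obtain ⟨m, M, hm, hM, hb⟩ := ha.exists_bounds_Icc one_pos he
  set μ := volume.restrict (Icc 1 (Real.exp 1) ∩ Ioi (0 : ℝ)) with hμ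
  have : IsFiniteMeasure μ :=
    ⟨by rw [hμ, Measure.restrict_apply_univ]
        exact (measure_mono inter_subset_left).trans_lt measure_Icc_lt_top⟩
  refine (MemLp.of_bound ?_ (M * (Real.exp 1 * ‖g‖)) ?_).eLpNorm_lt_top
  · exact (aestronglyMeasurable_jWeight ha aestronglyMeasurable_const).mono_measure
      (Measure.restrict_mono inter_subset_right le_rfl)
  · refine (ae_restrict_iff' (measurableSet_Icc.inter measurableSet_Ioi)).2
      (Filter.Eventually.of_forall fun t ht => ?_)
    have hw : t ^ (-0 - ((ENNReal.ofReal q)⁻¹).toReal) ≤ 1 :=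
      Real.rpow_le_one_of_one_le_of_nonpos ht.1.1 (by simp)
    have hw0 : 0 ≤ t ^ (-0 - ((ENNReal.ofReal q)⁻¹).toReal) := Real.rpow_nonneg ht.2.le _
    have ha0 := (ha.pos t ht.2).le
    rw [jWeight, Real.norm_of_nonneg (mul_nonneg (mul_nonneg hw0 ha0) (C.peetreJ_nonneg _ _))]
    gcongr
    · exact C.peetreJ_nonneg _ _
    · exact (mul_le_of_le_one_left ha0 hw).trans (hb t ht.1).2
    · exact C.peetreJ_le g he ht.1.2

/-! ### Truncation of representations -/

/-- On a compact subinterval of `(0, ∞)` a function with finite weighted `L_q`-norm is integrable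
in `X₀ ∩ X₁`. -/
theorem integrableOn_Icc_inter (ha : SlowlyVarying a) (hq : 1 ≤ q)
    (hu : AEStronglyMeasurable u (volume.restrict (Ioi (0 : ℝ))))
    (hfin : eLpNorm (C.jWeight q a u) (ENNReal.ofReal q) (volume.restrict (Ioi (0 : ℝ))) < ∞)
    {r R : ℝ} (hr : 0 < r) (hr1 : r ≤ 1) (hR : 1 ≤ R) :
    IntegrableOn (fun s : ℝ => s⁻¹ • u s) (Icc r R) := by
  obtain ⟨m, M, hm, hM, hb⟩ := ha.exists_bounds_Icc hr (hr1.trans hR)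
  have hsub : Icc r R ⊆ Ioi (0 : ℝ) := fun t ht => hr.trans_le ht.1
  have hw : Integrable (C.jWeight q a u) (volume.restrict (Icc r R)) := by
    -- `[r, R]` has finite measure, so `L_q` embeds in `L_1`.
    refine MemLp.integrable (q := ENNReal.ofReal q) (by simpa using hq) ?_
    exact MemLp.mono_measure (Measure.restrict_mono hsub le_rfl)
      ⟨aestronglyMeasurable_jWeight ha hu, hfin⟩
  set p : ℝ := ((ENNReal.ofReal q)⁻¹).toReal with hp
  have hp0 : 0 ≤ p := ENNReal.toReal_nonneg
  have hR0 : 0 < R := one_pos.trans_le hR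
  -- The three factors bound from below the power of `t` (least at `R`), the weight `a`, and `J(u t,
  -- t) / ‖u t‖`.
  set k : ℝ := R ^ (-0 - p) * m * r with hk
  have hk0 : 0 < k := mul_pos (mul_pos (Real.rpow_pos_of_pos hR0 _) hm) hr
  refine (hw.const_mul (r⁻¹ * k⁻¹)).mono' ?_ ?_
  · exact (measurable_inv.aestronglyMeasurable.smul
      (hu.mono_measure (Measure.restrict_mono hsub le_rfl)))
  · refine (ae_restrict_iff' measurableSet_Icc).2 (Filter.Eventually.of_forall fun t ht => ?_)
    have ht0 : 0 < t := hsub ht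
    have hle : k * ‖u t‖ ≤ C.jWeight q a u t := by
      have h1 : R ^ (-0 - p) ≤ t ^ (-0 - p) :=
        Real.rpow_le_rpow_of_nonpos ht0 ht.2 (by linarith)
      have h2 := C.mul_norm_le_peetreJ (u t) hr1 ht.1
      have h0 : 0 ≤ R ^ (-0 - p) := Real.rpow_nonneg hR0.le _
      have ha0 := (hb t ht).1
      calc k * ‖u t‖ = R ^ (-0 - p) * m * (r * ‖u t‖) := by rw [hk]; ring
        _ ≤ t ^ (-0 - p) * a t * C.peetreJ (u t) t := by
          refine mul_le_mul (mul_le_mul h1 ha0 hm.le (h0.trans h1)) h2 (by positivity) ?_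
          exact mul_nonneg (h0.trans h1) (hm.le.trans ha0)
    rw [norm_smul, Real.norm_of_nonneg (inv_nonneg.2 ht0.le), mul_assoc]
    have h3 : t⁻¹ ≤ r⁻¹ := inv_anti₀ hr ht.1
    gcongr
    rwa [← div_eq_inv_mul, le_div_iff₀ hk0, mul_comm]

/-- Removing the part over `[r, R]` from a representation subtracts an element of `X₀ ∩ X₁`. -/
theorem IsJRepresentation.sub_integral_Icc [CompleteSpace X₀] [CompleteSpace X₁]
    (h : C.IsJRepresentation f u) {r R : ℝ} (hr : 0 < r)
    (hint : IntegrableOn (fun s : ℝ => s⁻¹ • u s) (Icc r R)) :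
    C.IsJRepresentation (f - C.interToSum (∫ s in Icc r R, s⁻¹ • u s))
      ((Icc r R)ᶜ.indicator u) := by
  have hsub : Icc r R ⊆ Ioi (0 : ℝ) := fun t ht => hr.trans_le ht.1
  have hfun : (fun s : ℝ => s⁻¹ • C.interToSum ((Icc r R)ᶜ.indicator u s)) =
      (Icc r R)ᶜ.indicator fun s => s⁻¹ • C.interToSum (u s) := by
    ext s
    by_cases hs : s ∈ (Icc r R)ᶜ
    · rw [indicator_of_mem hs, indicator_of_mem hs]
    · rw [indicator_of_notMem hs, indicator_of_notMem hs, map_zero, smul_zero]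
  refine ⟨h.aestronglyMeasurable.indicator measurableSet_Icc.compl, ?_, ?_⟩
  · rw [hfun]
    exact h.integrableOn.indicator measurableSet_Icc.compl
  -- The integral taken in `X₀ ∩ X₁` agrees with the one in `X₀ + X₁`, since the inclusion is
  -- bounded and real-linear.
  · have hcomm : C.interToSum (∫ s in Icc r R, s⁻¹ • u s) =
        ∫ s in Icc r R, s⁻¹ • C.interToSum (u s) := by
      rw [← interToSumL_apply, ← ContinuousLinearMap.integral_comp_comm _ hint]
      simp only [map_smul, interToSumL_apply]
    rw [hfun, setIntegral_indicator measurableSet_Icc.compl, hcomm, ← h.integral_eq,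
      ← sdiff_eq, setIntegral_sdiff measurableSet_Icc h.integrableOn hsub]

end CompatibleCouple

/-- The `L_q`-norm of a function over the complement of a large compact subinterval of `(0, ∞)`
is small. -/
theorem exists_eLpNorm_indicator_Icc_compl_lt {w : ℝ → ℝ} {p : ℝ≥0∞} (hp0 : p ≠ 0) (hp : p ≠ ∞)
    (hw : eLpNorm w p (volume.restrict (Ioi (0 : ℝ))) < ∞) {ε : ℝ≥0∞} (hε : 0 < ε) :
    ∃ r R : ℝ, 0 < r ∧ r ≤ 1 ∧ 1 ≤ R ∧
      eLpNorm ((Icc r R)ᶜ.indicator w) p (volume.restrict (Ioi (0 : ℝ))) < ε := by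
  have hp' := ENNReal.toReal_pos hp0 hp
  set μ := volume.restrict (Ioi (0 : ℝ)) with hμ
  -- The `p`-th power of the norm over a set is its `ν`-mass. As `ν` is finite, continuity from
  -- above applies to the sets `S n`, which shrink to a `ν`-null set.
  set ν := μ.withDensity fun t => ‖w t‖ₑ ^ p.toReal with hν
  have hfin : ν univ < ∞ := by
    rw [hν, withDensity_apply _ MeasurableSet.univ, Measure.restrict_univ]
    exact lintegral_rpow_enorm_lt_top_of_eLpNorm_lt_top hp0 hp hw
  -- The shift to `n + 1` ensures `0 < r ≤ 1 ≤ R` already for `n = 0`.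
  let S : ℕ → Set ℝ := fun n => (Icc ((n : ℝ) + 1)⁻¹ ((n : ℝ) + 1))ᶜ
  have hS : Antitone S := by
    intro n k hnk
    have hnk' : (n : ℝ) ≤ k := by exact_mod_cast hnk
    refine compl_subset_compl.2 (Icc_subset_Icc ?_ (by linarith))
    exact inv_anti₀ (by positivity) (by linarith)
  have hSm : ∀ n, MeasurableSet (S n) := fun n => measurableSet_Icc.compl
  have hnull : ν (⋂ n, S n) = 0 := by
    refine (withDensity_absolutelyContinuous μ _) ?_
    rw [hμ, Measure.restrict_apply (MeasurableSet.iInter hSm)]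
    refine measure_mono_null (t := ∅) ?_ measure_empty
    rintro t ⟨ht, ht0⟩
    have ht0 : 0 < t := ht0
    obtain ⟨n, hn⟩ := exists_nat_ge (max t t⁻¹)
    refine mem_iInter.1 ht n ⟨?_, ?_⟩
    · rw [inv_le_comm₀ (by positivity) ht0]
      exact (le_max_right _ _).trans (hn.trans (by linarith))
    · exact (le_max_left _ _).trans (hn.trans (by linarith))
  have hlim := tendsto_measure_iInter_atTop (μ := ν) (fun n => (hSm n).nullMeasurableSet) hS
    ⟨0, ((measure_mono (subset_univ _)).trans_lt hfin).ne⟩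
  rw [hnull] at hlim
  have hlim' : Filter.Tendsto (fun n => ν (S n) ^ (1 / p.toReal)) Filter.atTop (nhds 0) := by
    have := ((ENNReal.continuous_rpow_const (y := 1 / p.toReal)).tendsto 0).comp hlim
    rwa [ENNReal.zero_rpow_of_pos (by positivity)] at this
  obtain ⟨n, hn⟩ := (hlim'.eventually (gt_mem_nhds hε)).exists
  refine ⟨((n : ℝ) + 1)⁻¹, (n : ℝ) + 1, by positivity, inv_le_one_of_one_le₀ (by simp), by simp, ?_⟩
  rw [eLpNorm_indicator_eq_eLpNorm_restrict (hSm n), eLpNorm_eq_lintegral_rpow_enorm_toReal hp0 hp,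
    ← withDensity_apply _ (hSm n)]
  exact hn

theorem theorem1p12 {𝕜 : Type*} [RCLike 𝕜]
    {X₀ : Type*} [NormedAddCommGroup X₀] [NormedSpace 𝕜 X₀] [CompleteSpace X₀]
    {X₁ : Type*} [NormedAddCommGroup X₁] [NormedSpace 𝕜 X₁] [CompleteSpace X₁]
    {E : Type*} [AddCommGroup E] [Module 𝕜 E] [TopologicalSpace E]
    [IsTopologicalAddGroup E] [ContinuousSMul 𝕜 E] [T2Space E]
    (C : CompatibleCouple 𝕜 X₀ X₁ E) (q : ℝ) (hq : 1 < q)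
    (a : ℝ → ℝ) (ha : SlowlyVarying a)
    (hint : ∫⁻ t in Ioi (0 : ℝ), ENNReal.ofReal (t⁻¹ * a t ^ (-q.conjExponent)) < ∞) :
    (∀ g : C.Inter, C.interToSum g ∈ C.jSpace 0 (ENNReal.ofReal q) a) ∧
    ∀ f ∈ C.jSpace 0 (ENNReal.ofReal q) a, ∀ ε : ℝ≥0∞, 0 < ε →
      ∃ g : C.Inter, C.jNorm 0 (ENNReal.ofReal q) a (f - C.interToSum g) < ε := by
  refine ⟨CompatibleCouple.interToSum_mem_jSpace ha, fun f hf ε hε => ?_⟩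
  obtain ⟨u, hlt⟩ := iInf_lt_iff.1 (show C.jNorm 0 (ENNReal.ofReal q) a f < ∞ from hf)
  obtain ⟨hu, hlt⟩ := iInf_lt_iff.1 hlt
  have hq0 : ENNReal.ofReal q ≠ 0 := by simpa using one_pos.trans hq
  obtain ⟨r, R, hr, hr1, hR, hsmall⟩ :=
    exists_eLpNorm_indicator_Icc_compl_lt (w := C.jWeight q a u) hq0 ENNReal.ofReal_ne_top hlt hε
  have hint' := CompatibleCouple.integrableOn_Icc_inter ha hq.le hu.aestronglyMeasurable hlt
    hr hr1 hR
  -- The approximant, found by unification, is `∫_{[r, R]} u(s) ds/s` in `X₀ ∩ X₁`.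
  refine ⟨_, (CompatibleCouple.jNorm_le (hu.sub_integral_Icc hr hint')).trans_lt ?_⟩
  rwa [CompatibleCouple.jWeight_indicator]
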